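/- Let $G$ be a locally compact (Hausdorff) group with a left Haar measure, and call $G$ amenable if there is a left-invariant mean on $L^\infty(G)$, i.e. a bounded linear functional $m$ on $L^\infty(G)$ with $\|m\|=m(1)=1$ and $m(f(s\,\cdot))=m(f)$ for all $s\in G$, $f\in L^\infty(G)$. For a complex Banach space $E$, a weak$^*$-continuous affine-linear action of $G$ on the dual space $E^*$ is a group action $\alpha$ of $G$ on $E^*$ such that each $\alpha_t$ is of the form $\varphi\mapsto L_t\varphi+c_t$ with $L_t:E^*\to E^*$ complex-linear and $c_t\in E^*$, each $\alpha_t$ is weak$^*$-to-weak$^*$ continuous, and $t\mapsto\alpha_t(\varphi)$ is weak$^*$-continuous for each $\varphi\in E^*$. Then the following statements are equivalent. 1. $G$ is amenable. 2. For every complex Banach space $E$, every weak$^*$-continuous affine-linear action $\alpha$ of $G$ on $E^*$ that has at least one norm-bounded orbit $\{\alpha_t(\varphi):t\in G\}$ has a fixed point, i.e. there is $\varphi_0\in E^*$ with $\alpha_t(\varphi_0)=\varphi_0$ for all $t\in G$. 3. For every complex Banach space $E$, every weak$^*$-continuous affine-linear action of $G$ on $E^*$ all of whose orbits are norm-bounded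 has a fixed point. -/

import Mathlib

open MeasureTheory
open scoped ENNReal

universe u v

section Amenability

variable {G : Type u} [Group G] [TopologicalSpace G] [IsTopologicalGroup G]
  [LocallyCompactSpace G] [MeasurableSpace G] [BorelSpace G]

/-- The left translate `t ↦ f (s * t)` of a class `f ∈ L^∞(G)` (with respect to left Haar
measure). -/
noncomputable def leftTranslate (s : G) (f : Lp ℂ ∞ (Measure.haar : Measure G)) :
    Lp ℂ ∞ (Measure.haar : Measure G) :=
  Lp.compMeasurePreserving (fun t : G => s * t) (measurePreserving_mul_left Measure.haar s) f

variable (G) in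
/-- The class of the constant function `1` in `L^∞(G)`. -/
noncomputable def oneLinfty : Lp ℂ ∞ (Measure.haar : Measure G) :=
  (memLp_top_const (1 : ℂ)).toLp (fun _ : G => (1 : ℂ))

/-- A left-invariant mean on `L^∞(G)`: a functional `m` with `‖m‖ = m(1) = 1` that is invariant
under all left translations. -/
structure IsLeftInvariantMean (m : StrongDual ℂ (Lp ℂ ∞ (Measure.haar : Measure G))) : Prop where
  norm_eq_one : ‖m‖ = 1
  map_one : m (oneLinfty G) = 1
  map_leftTranslate : ∀ (s : G) (f : Lp ℂ ∞ (Measure.haar : Measure G)),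
    m (leftTranslate s f) = m f

variable (G) in
/-- A locally compact group is amenable if `L^∞(G)` carries a left-invariant mean. -/
def IsAmenableGroup : Prop :=
  ∃ m : StrongDual ℂ (Lp ℂ ∞ (Measure.haar : Measure G)), IsLeftInvariantMean m

end Amenability

section AffineActions

variable {G : Type u} [Group G] [TopologicalSpace G]
  {E : Type v} [NormedAddCommGroup E] [NormedSpace ℂ E]

/-- A map of a complex vector space to itself is affine-linear if it is the sum of a complex-linear
map and a constant. -/
def IsAffineLinear {X : Type v} [AddCommGroup X] [Module ℂ X] (S : X → X) : Prop :=
  ∃ (L : X →ₗ[ℂ] X) (c : X), ∀ x, S x = L x + c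

/-- `α` is an action of `G` on the dual space `E*` by affine-linear maps that is weak*-continuous:
every `α t` is weak*-to-weak* continuous, and every orbit map `t ↦ α t φ` is weak*-continuous.
(`WeakDual ℂ E` is the space of bounded functionals on `E` with the weak* topology.) -/
structure IsWeakStarAffineAction (α : G → WeakDual ℂ E → WeakDual ℂ E) : Prop where
  one_act : ∀ φ, α 1 φ = φ
  mul_act : ∀ s t φ, α (s * t) φ = α s (α t φ)
  affine : ∀ t, IsAffineLinear (α t)
  continuous_act : ∀ t, Continuous (α t)
  continuous_orbit : ∀ φ, Continuous fun t => α t φ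

/-- The orbit of `φ` under `α` is bounded for the dual norm of `E*`. -/
def HasNormBoundedOrbit (α : G → WeakDual ℂ E → WeakDual ℂ E) (φ : WeakDual ℂ E) : Prop :=
  Bornology.IsBounded (Set.range fun t => WeakDual.toStrongDual (α t φ))

end AffineActions

/-! If `m` is an invariant mean and the orbit of `φ` is bounded, then `ψ x = m (t ↦ α t φ x)`
defines a functional on `E`. Weak*-continuity of the linear part of `α s` makes it the transpose of
a map on `E`, so `s` can be moved inside the mean, and invariance together with `m 1 = 1` gives `α s
ψ = ψ`. This is `IsLeftInvariantMean.exists_fixed_point`; condition 2 trivially implies condition 3.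

For the converse, let UC be the space of bounded continuous functions with norm-continuous
left-translation orbit. Functionals on UC with value 1 at the constant 1 form an affine space on
which `G` acts. Taking evaluation at the identity as origin turns it into the dual of the Banach
space of functions in UC vanishing at the identity, and all orbits there are bounded. A fixed point
is an invariant functional with value 1 at 1, possibly not positive. The modulus of its real part is
positive, still invariant, and at least 1 at the constant 1, so it can be normalised to a mean `P`
on UC.

To reach `L^∞`, convolve `f` with a compactly supported kernel `k` of mass one and apply `P`. As a
functional of `k`, `P (haarConv f k)` is left invariant, hence by uniqueness of Haar measure a
multiple of the mass of `k`. Translating `f` amounts to right-translating `k`, up to a modular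
factor that cancels, so the smoothed mean is invariant. -/

/-! ### Affine actions on a dual induced by operators on the predual -/

section CocycleActions

variable {G : Type u}

/-- The affine action `φ ↦ φ ∘ T t + c t` on the dual attached to a cocycle of operators. -/
noncomputable def cocycleAction {X : Type v} [NormedAddCommGroup X] [NormedSpace ℂ X]
    (T : G → X →L[ℂ] X) (c : G → StrongDual ℂ X) (t : G) (φ : WeakDual ℂ X) : WeakDual ℂ X :=
  StrongDual.toWeakDual ((WeakDual.toStrongDual φ).comp (T t) + c t)

theorem cocycleAction_apply {X : Type v} [NormedAddCommGroup X] [NormedSpace ℂ X]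
    (T : G → X →L[ℂ] X) (c : G → StrongDual ℂ X) (t : G) (φ : WeakDual ℂ X) (x : X) :
    cocycleAction T c t φ x = φ (T t x) + c t x := rfl

/-- Transposition reverses products, so `T` has to be an anti-homomorphism. Since the linear parts
are transposes, their weak*-continuity is automatic. -/
theorem isWeakStarAffineAction_cocycleAction [Group G] [TopologicalSpace G]
    {X : Type v} [NormedAddCommGroup X] [NormedSpace ℂ X]
    {T : G → X →L[ℂ] X} {c : G → StrongDual ℂ X}
    (T_one : ∀ x, T 1 x = x) (T_mul : ∀ s t x, T (s * t) x = T t (T s x))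
    (c_one : ∀ x, c 1 x = 0) (c_mul : ∀ s t x, c (s * t) x = c t (T s x) + c s x)
    (T_cont : ∀ x, Continuous fun t => T t x) (c_cont : ∀ x, Continuous fun t => c t x) :
    IsWeakStarAffineAction (cocycleAction T c) where
  one_act φ := by
    refine DFunLike.ext _ _ fun x => ?_
    rw [cocycleAction_apply, T_one, c_one, add_zero]
  mul_act s t φ := by
    refine DFunLike.ext _ _ fun x => ?_
    rw [cocycleAction_apply, cocycleAction_apply, cocycleAction_apply, T_mul, c_mul, add_assoc]
  affine t :=
    ⟨{ toFun := fun φ => StrongDual.toWeakDual ((WeakDual.toStrongDual φ).comp (T t))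
       map_add' := fun _ _ => rfl
       map_smul' := fun _ _ => rfl }, StrongDual.toWeakDual (c t), fun _ => rfl⟩
  continuous_act t := by
    refine WeakBilin.continuous_of_continuous_eval _ fun x => ?_
    exact (WeakDual.eval_continuous (T t x)).add continuous_const
  continuous_orbit φ := by
    refine WeakBilin.continuous_of_continuous_eval _ fun x => ?_
    exact ((WeakDual.toStrongDual φ).continuous.comp (T_cont x)).add (c_cont x)

theorem hasNormBoundedOrbit_cocycleAction {X : Type v} [NormedAddCommGroup X]
    [NormedSpace ℂ X] {T : G → X →L[ℂ] X} {c : G → StrongDual ℂ X} {A B : ℝ}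
    (hT : ∀ t, ‖T t‖ ≤ A) (hc : ∀ t, ‖c t‖ ≤ B) (φ : WeakDual ℂ X) :
    HasNormBoundedOrbit (cocycleAction T c) φ := by
  refine isBounded_iff_forall_norm_le.2 ⟨‖WeakDual.toStrongDual φ‖ * A + B, ?_⟩
  rintro _ ⟨t, rfl⟩
  calc ‖(WeakDual.toStrongDual φ).comp (T t) + c t‖
      ≤ ‖(WeakDual.toStrongDual φ).comp (T t)‖ + ‖c t‖ := norm_add_le _ _
    _ ≤ ‖WeakDual.toStrongDual φ‖ * A + B := by
        gcongr
        · exact (ContinuousLinearMap.opNorm_comp_le _ _).trans (by gcongr; exact hT t)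
        · exact hc t

variable [Group G] [TopologicalSpace G]

variable (G) in
/-- Every weak*-continuous affine-linear action of `G` on a dual space all of whose orbits are
norm-bounded has a fixed point. -/
def BoundedOrbitsFixedPointProperty : Prop :=
  ∀ (E : Type (max u v)) [NormedAddCommGroup E] [NormedSpace ℂ E] [CompleteSpace E]
    (α : G → WeakDual ℂ E → WeakDual ℂ E),
    IsWeakStarAffineAction α → (∀ φ, HasNormBoundedOrbit α φ) → ∃ φ, ∀ t, α t φ = φ

theorem BoundedOrbitsFixedPointProperty.exists_fixed_functional
    (H : BoundedOrbitsFixedPointProperty.{u, v} G)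
    {X : Type u} [NormedAddCommGroup X] [NormedSpace ℂ X] [CompleteSpace X]
    {T : G → X →L[ℂ] X} {c : G → StrongDual ℂ X} {A B : ℝ}
    (T_one : ∀ x, T 1 x = x) (T_mul : ∀ s t x, T (s * t) x = T t (T s x))
    (c_one : ∀ x, c 1 x = 0) (c_mul : ∀ s t x, c (s * t) x = c t (T s x) + c s x)
    (T_cont : ∀ x, Continuous fun t => T t x) (c_cont : ∀ x, Continuous fun t => c t x)
    (hT : ∀ t, ‖T t‖ ≤ A) (hc : ∀ t, ‖c t‖ ≤ B) :
    ∃ φ : StrongDual ℂ X, ∀ t x, φ (T t x) + c t x = φ x := by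
  -- The property quantifies over spaces in `Type (max u v)`, so the action is transported to an
  -- isometric copy of `X` there.
  let e : ULift.{v} X ≃ₗᵢ[ℂ] X := LinearIsometryEquiv.ulift ℂ X
  let d : ULift.{v} X →L[ℂ] X := e.toContinuousLinearEquiv.toContinuousLinearMap
  let i : X →L[ℂ] ULift.{v} X := e.symm.toContinuousLinearEquiv.toContinuousLinearMap
  have A0 : 0 ≤ A := (norm_nonneg _).trans (hT 1)
  have B0 : 0 ≤ B := (norm_nonneg _).trans (hc 1)
  obtain ⟨φ, hφ⟩ := H (ULift.{v} X)
    (cocycleAction (fun t => i.comp ((T t).comp d)) (fun t => (c t).comp d))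
    (isWeakStarAffineAction_cocycleAction (fun x => congrArg i (T_one (d x)))
      (fun s t x => congrArg i (T_mul s t (d x))) (fun x => c_one (d x))
      (fun s t x => c_mul s t (d x)) (fun x => i.continuous.comp (T_cont (d x)))
      (fun x => c_cont (d x)))
    (hasNormBoundedOrbit_cocycleAction (A := A) (B := B)
      (fun t => ContinuousLinearMap.opNorm_le_bound _ A0 fun x => (T t).le_of_opNorm_le (hT t) _)
      (fun t => ContinuousLinearMap.opNorm_le_bound _ B0 fun x => (c t).le_of_opNorm_le (hc t) _))
  refine ⟨(WeakDual.toStrongDual φ).comp i, fun t x => ?_⟩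
  exact DFunLike.congr_fun (hφ t) (i x)

end CocycleActions

/-! ### Functions with norm-continuous left-translation orbit -/

section UniformlyContinuous

open scoped BoundedContinuousFunction
open Topology

variable {G : Type u} [Group G] [TopologicalSpace G] [IsTopologicalGroup G]
  {𝕜 : Type*} [RCLike 𝕜]

/-- The left translation `f ↦ f (s * ·)` on bounded continuous functions. -/
noncomputable def leftShift (s : G) : (G →ᵇ 𝕜) →L[𝕜] (G →ᵇ 𝕜) :=
  LinearMap.mkContinuous
    { toFun := fun f => f.compContinuous ⟨fun t => s * t, continuous_const_mul s⟩
      map_add' := fun _ _ => rfl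
      map_smul' := fun _ _ => rfl } 1
    fun f => by
      rw [one_mul]
      exact f.norm_compContinuous_le _

@[simp]
theorem leftShift_apply (s : G) (f : G →ᵇ 𝕜) (t : G) : leftShift s f t = f (s * t) := rfl

theorem norm_leftShift_le (s : G) (f : G →ᵇ 𝕜) : ‖leftShift s f‖ ≤ ‖f‖ :=
  f.norm_compContinuous_le _

theorem leftShift_mul (s t : G) (f : G →ᵇ 𝕜) :
    leftShift (s * t) f = leftShift t (leftShift s f) := by
  ext x
  simp [mul_assoc]

theorem leftShift_one (f : G →ᵇ 𝕜) : leftShift 1 f = f := by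
  ext x
  simp

variable (G 𝕜) in
/-- The bounded continuous functions with a norm-continuous orbit under left translations. -/
def uniformlyContinuousSubmodule : Submodule 𝕜 (G →ᵇ 𝕜) where
  carrier := {f | Continuous fun s : G => leftShift s f}
  add_mem' hf hg := Continuous.add hf hg
  zero_mem' := continuous_const (y := (0 : G →ᵇ 𝕜))
  smul_mem' c _ hf := Continuous.const_smul hf c

theorem mem_uniformlyContinuousSubmodule {f : G →ᵇ 𝕜} :
    f ∈ uniformlyContinuousSubmodule G 𝕜 ↔ Continuous fun s : G => leftShift s f := Iff.rfl

theorem leftShift_mem_uniformlyContinuousSubmodule (s : G) {f : G →ᵇ 𝕜}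
    (hf : f ∈ uniformlyContinuousSubmodule G 𝕜) :
    leftShift s f ∈ uniformlyContinuousSubmodule G 𝕜 := by
  have : Continuous fun t : G => leftShift (s * t) f :=
    Continuous.comp (g := fun t : G => leftShift t f) hf (continuous_const_mul s)
  simpa only [mem_uniformlyContinuousSubmodule, leftShift_mul] using this

theorem one_mem_uniformlyContinuousSubmodule :
    (1 : G →ᵇ 𝕜) ∈ uniformlyContinuousSubmodule G 𝕜 :=
  continuous_const (y := (1 : G →ᵇ 𝕜))

theorem isClosed_uniformlyContinuousSubmodule :
    IsClosed (uniformlyContinuousSubmodule G 𝕜 : Set (G →ᵇ 𝕜)) := by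
  refine isClosed_of_closure_subset fun f hf => ?_
  refine continuous_of_uniform_approx_of_continuous fun U hU => ?_
  obtain ⟨ε, ε0, hε⟩ := Metric.mem_uniformity_dist.1 hU
  obtain ⟨g, hg, hfg⟩ := Metric.mem_closure_iff.1 hf ε ε0
  refine ⟨fun s => leftShift s g, hg, fun s => hε ?_⟩
  rw [dist_eq_norm, ← map_sub]
  exact (norm_leftShift_le _ _).trans_lt (by rwa [← dist_eq_norm])

/-- Lattice operations are norm-continuous and commute with translation. The space is thus a vector
lattice, as the modulus construction requires. -/
theorem abs_mem_uniformlyContinuousSubmodule {f : G →ᵇ ℝ}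
    (hf : f ∈ uniformlyContinuousSubmodule G ℝ) : |f| ∈ uniformlyContinuousSubmodule G ℝ := by
  have : Continuous fun s : G => leftShift s f ⊔ -leftShift s f := Continuous.sup hf hf.neg
  exact this

/-- Translations are contractions, so continuity of the orbit map at the identity propagates to
every point. -/
theorem mem_uniformlyContinuousSubmodule_of_norm_shift_sub_le {f : G →ᵇ 𝕜} {ω : G → ℝ}
    (hω : Filter.Tendsto ω (𝓝 1) (𝓝 0)) (h : ∀ s, ‖leftShift s f - f‖ ≤ ω s) :
    f ∈ uniformlyContinuousSubmodule G 𝕜 := by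
  refine continuous_iff_continuousAt.2 fun s => ?_
  have h1 : Filter.Tendsto (fun t => ω (t * s⁻¹)) (𝓝 s) (𝓝 0) :=
    hω.comp ((continuous_mul_const s⁻¹).tendsto' _ _ (mul_inv_cancel s))
  refine tendsto_iff_norm_sub_tendsto_zero.2 (squeeze_zero (fun _ => norm_nonneg _) ?_ h1)
  intro t
  have : leftShift t f - leftShift s f = leftShift s (leftShift (t * s⁻¹) f - f) := by
    rw [map_sub, ← leftShift_mul, inv_mul_cancel_right]
  rw [this]
  exact (norm_leftShift_le _ _).trans (h _)

end UniformlyContinuous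

/-! ### From a fixed point to an invariant functional -/

section InvariantFunctional

open scoped BoundedContinuousFunction

variable {G : Type u} [Group G] [TopologicalSpace G] [IsTopologicalGroup G]

variable (G) in
/-- The functions in `uniformlyContinuousSubmodule G ℂ` that vanish at the identity. -/
noncomputable def pointedUniformlyContinuous : Submodule ℂ (G →ᵇ ℂ) :=
  uniformlyContinuousSubmodule G ℂ ⊓
    (LinearMap.ker (BoundedContinuousFunction.evalCLM ℂ (1 : G) : (G →ᵇ ℂ) →L[ℂ] ℂ).toLinearMap)

theorem mem_pointedUniformlyContinuous {f : G →ᵇ ℂ} :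
    f ∈ pointedUniformlyContinuous G ↔ f ∈ uniformlyContinuousSubmodule G ℂ ∧ f 1 = 0 := Iff.rfl

instance : CompleteSpace (pointedUniformlyContinuous G) := by
  refine IsClosed.completeSpace_coe (hs := ?_)
  exact isClosed_uniformlyContinuousSubmodule.inter (ContinuousLinearMap.isClosed_ker _)

theorem sub_const_mem_pointedUniformlyContinuous {f : G →ᵇ ℂ}
    (hf : f ∈ uniformlyContinuousSubmodule G ℂ) :
    f - f 1 • (1 : G →ᵇ ℂ) ∈ pointedUniformlyContinuous G :=
  mem_pointedUniformlyContinuous.2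
    ⟨sub_mem hf (Submodule.smul_mem _ _ one_mem_uniformlyContinuousSubmodule), by simp⟩

/-- The operator `f ↦ f (s * ·) - f s` on the functions vanishing at the identity. -/
noncomputable def pointedShift (s : G) :
    pointedUniformlyContinuous G →L[ℂ] pointedUniformlyContinuous G :=
  LinearMap.mkContinuous
    { toFun := fun f => ⟨leftShift s f.1 - leftShift s f.1 1 • (1 : G →ᵇ ℂ),
        sub_const_mem_pointedUniformlyContinuous
          (leftShift_mem_uniformlyContinuousSubmodule s f.2.1)⟩
      map_add' := fun f g => by ext x; simp; ring
      map_smul' := fun c f => by ext x; simp; ring } 2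
    fun f => by
      refine (norm_sub_le (leftShift s f.1) (leftShift s f.1 1 • (1 : G →ᵇ ℂ))).trans ?_
      rw [norm_smul, norm_one, mul_one, two_mul]
      exact add_le_add (norm_leftShift_le _ _)
        ((BoundedContinuousFunction.norm_coe_le_norm _ _).trans (norm_leftShift_le _ _))

@[simp]
theorem pointedShift_apply (s : G) (f : pointedUniformlyContinuous G) (t : G) :
    (pointedShift s f : G →ᵇ ℂ) t = (f : G →ᵇ ℂ) (s * t) - (f : G →ᵇ ℂ) s := by
  simp [pointedShift]

theorem norm_pointedShift_le (s : G) : ‖pointedShift s‖ ≤ 2 :=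
  LinearMap.mkContinuous_norm_le _ zero_le_two _

theorem continuous_pointedShift (f : pointedUniformlyContinuous G) :
    Continuous fun s => pointedShift s f := by
  refine Continuous.subtype_mk (f := fun s => leftShift s f.1 - leftShift s f.1 1 • 1) ?_ _
  have h : Continuous fun s : G => leftShift s f.1 := f.2.1
  have h' : Continuous fun s : G => leftShift s f.1 1 := by
    simpa using f.1.continuous
  exact h.sub (h'.smul continuous_const)

/-- Evaluation at `s` on the functions vanishing at the identity. -/
noncomputable def pointedEval (s : G) : StrongDual ℂ (pointedUniformlyContinuous G) :=
  (BoundedContinuousFunction.evalCLM ℂ s).comp (pointedUniformlyContinuous G).subtypeL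

theorem pointedEval_apply (s : G) (f : pointedUniformlyContinuous G) :
    pointedEval s f = (f : G →ᵇ ℂ) s := rfl

theorem norm_pointedEval_le (s : G) : ‖pointedEval s‖ ≤ 1 :=
  ContinuousLinearMap.opNorm_le_bound _ zero_le_one fun f => by
    rw [one_mul]
    exact f.1.norm_coe_le_norm s

/-- A fixed `φ` on the functions vanishing at the identity yields `m f = φ (f - f 1) + f 1`; the
cocycle `pointedEval` is exactly the displacement of the origin, evaluation at the identity.
Positivity of `m` is not available yet. -/
theorem BoundedOrbitsFixedPointProperty.exists_invariant_functional
    (H : BoundedOrbitsFixedPointProperty.{u, v} G) :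
    ∃ m : StrongDual ℂ (uniformlyContinuousSubmodule G ℂ),
      (∀ h, m ⟨1, h⟩ = 1) ∧ ∀ (s : G) f (hf : f ∈ uniformlyContinuousSubmodule G ℂ),
        m ⟨leftShift s f, leftShift_mem_uniformlyContinuousSubmodule s hf⟩ = m ⟨f, hf⟩ := by
  obtain ⟨φ, hφ⟩ := H.exists_fixed_functional (T := pointedShift) (c := pointedEval)
    (fun f => by ext x; simp [(mem_pointedUniformlyContinuous.1 f.2).2])
    (fun s t f => by ext x; simp [mul_assoc])
    (fun f => (mem_pointedUniformlyContinuous.1 f.2).2)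
    (fun s t f => by simp [pointedEval_apply])
    continuous_pointedShift (fun f => f.1.continuous) norm_pointedShift_le norm_pointedEval_le
  let q : uniformlyContinuousSubmodule G ℂ →L[ℂ] pointedUniformlyContinuous G :=
    { toFun := fun f => ⟨f.1 - f.1 1 • (1 : G →ᵇ ℂ), sub_const_mem_pointedUniformlyContinuous f.2⟩
      map_add' := fun f g => by ext x; simp; ring
      map_smul' := fun c f => by ext x; simp; ring
      cont := by
        refine Continuous.subtype_mk ?_ _
        have : Continuous fun f : uniformlyContinuousSubmodule G ℂ => f.1 1 :=
          (continuous_eval_const (F := G →ᵇ ℂ) (1 : G)).comp continuous_subtype_val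
        exact continuous_subtype_val.sub (this.smul continuous_const) }
  let ev : StrongDual ℂ (uniformlyContinuousSubmodule G ℂ) :=
    (BoundedContinuousFunction.evalCLM ℂ (1 : G)).comp (uniformlyContinuousSubmodule G ℂ).subtypeL
  refine ⟨φ.comp q + ev, fun h => ?_, fun s f hf => ?_⟩
  · have : q ⟨1, h⟩ = 0 := by ext x; simp [q]
    simp [this, ev]
  · have h1 : q ⟨leftShift s f, leftShift_mem_uniformlyContinuousSubmodule s hf⟩
        = pointedShift s (q ⟨f, hf⟩) := by
      ext x; simp [q]
    have h2 := hφ s (q ⟨f, hf⟩)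
    have h3 : pointedEval s (q ⟨f, hf⟩) = f s - f 1 := by simp [pointedEval_apply, q]
    have h4 : ev ⟨leftShift s f, leftShift_mem_uniformlyContinuousSubmodule s hf⟩ = f s := by
      simp [ev]
    have h5 : ev ⟨f, hf⟩ = f 1 := rfl
    simp only [add_apply, ContinuousLinearMap.comp_apply, h1, h4, h5, ← h2, h3]
    ring

end InvariantFunctional

/-! ### The modulus of a bounded functional on a vector lattice -/

section PositivePart

open scoped BoundedContinuousFunction Pointwise

variable {X : Type*} [TopologicalSpace X] {V : Submodule ℝ (X →ᵇ ℝ)}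

/-- The values of `u` on the functions dominated by `f`. -/
def dominatedValues (u : V →ₗ[ℝ] ℝ) (f : X →ᵇ ℝ) : Set ℝ :=
  u '' {g : V | ∀ x, |g.1 x| ≤ f x}

theorem dominatedValues_nonempty (u : V →ₗ[ℝ] ℝ) {f : X →ᵇ ℝ} (hf : ∀ x, 0 ≤ f x) :
    (dominatedValues u f).Nonempty :=
  ⟨u 0, 0, fun x => by simpa using hf x, rfl⟩

theorem le_of_mem_dominatedValues {u : V →ₗ[ℝ] ℝ} {C : ℝ} (hC : 0 ≤ C)
    (hu : ∀ g, |u g| ≤ C * ‖g.1‖) {f : X →ᵇ ℝ} {y : ℝ} (hy : y ∈ dominatedValues u f) :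
    y ≤ C * ‖f‖ := by
  obtain ⟨g, hg, rfl⟩ := hy
  have : ‖g.1‖ ≤ ‖f‖ := (BoundedContinuousFunction.norm_le (norm_nonneg _)).2 fun x =>
    (hg x).trans ((le_abs_self _).trans (f.norm_coe_le_norm x))
  exact (le_abs_self _).trans ((hu g).trans (mul_le_mul_of_nonneg_left this hC))

theorem bddAbove_dominatedValues {u : V →ₗ[ℝ] ℝ} {C : ℝ} (hC : 0 ≤ C)
    (hu : ∀ g, |u g| ≤ C * ‖g.1‖) (f : X →ᵇ ℝ) : BddAbove (dominatedValues u f) :=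
  ⟨_, fun _ => le_of_mem_dominatedValues hC hu⟩

/-- Riesz decomposition: a function dominated by `f₁ + f₂` splits into parts dominated by `f₁` and
by `f₂`. -/
theorem dominatedValues_add (hV : ∀ f ∈ V, |f| ∈ V) (u : V →ₗ[ℝ] ℝ) {f₁ f₂ : X →ᵇ ℝ}
    (h₁ : f₁ ∈ V) (hf₁ : ∀ x, 0 ≤ f₁ x) (hf₂ : ∀ x, 0 ≤ f₂ x) :
    dominatedValues u (f₁ + f₂) = dominatedValues u f₁ + dominatedValues u f₂ := by
  have hsup : ∀ a ∈ V, ∀ b ∈ V, a ⊔ b ∈ V := fun a ha b hb => by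
    have : a ⊔ b = (2⁻¹ : ℝ) • (a + b + |b - a|) := by
      ext x
      simp only [BoundedContinuousFunction.coe_sup, BoundedContinuousFunction.coe_smul,
        BoundedContinuousFunction.coe_add, BoundedContinuousFunction.coe_abs, Pi.sup_apply,
        Pi.add_apply, Pi.abs_apply, smul_eq_mul, BoundedContinuousFunction.coe_sub, Pi.sub_apply]
      rcases le_total (a x) (b x) with h | h
      · rw [sup_of_le_right h, abs_of_nonneg (by linarith)]; ring
      · rw [sup_of_le_left h, abs_of_nonpos (by linarith)]; ring
    rw [this]
    exact V.smul_mem _ (add_mem (add_mem ha hb) (hV _ (sub_mem hb ha)))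
  refine Set.Subset.antisymm ?_ ?_
  · rintro _ ⟨g, hg, rfl⟩
    -- This is `g` truncated to the interval from `-f₁` to `f₁`; what remains of `g` is dominated by
    -- `f₂`.
    have hk : -((-g.1) ⊔ (-f₁)) ⊔ (-f₁) ∈ V :=
      hsup _ (neg_mem (hsup _ (neg_mem g.2) _ (neg_mem h₁))) _ (neg_mem h₁)
    have key : ∀ x, (-((-g.1) ⊔ (-f₁)) ⊔ (-f₁)) x = max (-max (-g.1 x) (-f₁ x)) (-f₁ x) :=
      fun x => rfl
    refine Set.mem_add.2 ⟨_, ⟨⟨_, hk⟩, fun x => ?_, rfl⟩, _, ⟨g - ⟨_, hk⟩, fun x => ?_, rfl⟩, ?_⟩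
    · have h1 := hf₁ x
      rw [key, abs_le]
      grind
    · have h1 := hf₁ x
      have h2 := hf₂ x
      have h3 := abs_le.1 (hg x)
      have h4 : (f₁ + f₂) x = f₁ x + f₂ x := rfl
      rw [h4] at h3
      have h5 : (g - ⟨_, hk⟩ : V).1 x = g.1 x - (-((-g.1) ⊔ (-f₁)) ⊔ (-f₁)) x := rfl
      rw [h5, key, abs_le]
      grind
    · rw [← map_add]
      exact congrArg u (add_sub_cancel _ g)
  · rintro _ ⟨_, ⟨g₁, hg₁, rfl⟩, _, ⟨g₂, hg₂, rfl⟩, rfl⟩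
    exact ⟨g₁ + g₂, fun x => (abs_add_le _ _).trans (add_le_add (hg₁ x) (hg₂ x)), map_add u _ _⟩

theorem nonneg_add_norm_smul_one (f : X →ᵇ ℝ) {a : ℝ} (ha : ‖f‖ ≤ a) (x : X) :
    0 ≤ (f + a • (1 : X →ᵇ ℝ)) x := by
  have := (abs_le.1 ((f.norm_coe_le_norm x).trans ha)).1
  simp only [BoundedContinuousFunction.coe_add, BoundedContinuousFunction.coe_smul, Pi.add_apply,
    BoundedContinuousFunction.coe_one, Pi.one_apply, smul_eq_mul, mul_one]
  linarith

/-- The modulus of a bounded functional on a vector lattice of bounded continuous functions. -/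
theorem exists_isLUB_dominatedValues (hV : ∀ f ∈ V, |f| ∈ V) (h1 : (1 : X →ᵇ ℝ) ∈ V)
    {u : V →ₗ[ℝ] ℝ} {C : ℝ} (hC : 0 ≤ C) (hu : ∀ g, |u g| ≤ C * ‖g.1‖) :
    ∃ P : V →ₗ[ℝ] ℝ, ∀ f : V, (∀ x, 0 ≤ f.1 x) → IsLUB (dominatedValues u f.1) (P f) := by
  let p : (X →ᵇ ℝ) → ℝ := fun f => sSup (dominatedValues u f)
  have p_add : ∀ {f₁ f₂ : X →ᵇ ℝ}, f₁ ∈ V → (∀ x, 0 ≤ f₁ x) → (∀ x, 0 ≤ f₂ x) →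
      p (f₁ + f₂) = p f₁ + p f₂ := fun h hf₁ hf₂ => by
    simp only [p, dominatedValues_add hV u h hf₁ hf₂]
    exact csSup_add (dominatedValues_nonempty u hf₁) (bddAbove_dominatedValues hC hu _)
      (dominatedValues_nonempty u hf₂) (bddAbove_dominatedValues hC hu _)
  have p_nonneg : ∀ {f : X →ᵇ ℝ}, (∀ x, 0 ≤ f x) → 0 ≤ p f := fun hf =>
    le_csSup (bddAbove_dominatedValues hC hu _) ⟨0, fun x => by simpa using hf x, map_zero u⟩
  have p_le : ∀ {f : X →ᵇ ℝ}, (∀ x, 0 ≤ f x) → p f ≤ C * ‖f‖ := fun hf =>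
    csSup_le (dominatedValues_nonempty u hf) fun _ => le_of_mem_dominatedValues hC hu
  let e : ℝ → X →ᵇ ℝ := fun a => a • 1
  have e_mem : ∀ a, e a ∈ V := fun a => V.smul_mem a h1
  have e_nonneg : ∀ {a : ℝ}, 0 ≤ a → ∀ x, 0 ≤ e a x := fun ha x => by simpa [e] using ha
  have e_norm : ∀ {a : ℝ}, 0 ≤ a → ‖e a‖ ≤ a := fun {a} ha =>
    (BoundedContinuousFunction.norm_le ha).2 fun x => by simp [e, abs_of_nonneg ha]
  -- `p` is additive only on nonnegative functions. It is extended by adding a constant that makes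
  -- `f` nonnegative; `Q_eq` shows that any large enough constant gives the same value.
  let Q : (X →ᵇ ℝ) → ℝ := fun f => p (f + e ‖f‖) - p (e ‖f‖)
  have Q_eq : ∀ {f : X →ᵇ ℝ} {a : ℝ}, f ∈ V → ‖f‖ ≤ a → Q f = p (f + e a) - p (e a) := by
    intro f a hf ha
    have a0 := (norm_nonneg f).trans ha
    have h2 := p_add (add_mem hf (e_mem a)) (nonneg_add_norm_smul_one f ha)
      (e_nonneg (norm_nonneg f))
    have h3 := p_add (add_mem hf (e_mem ‖f‖)) (nonneg_add_norm_smul_one f le_rfl) (e_nonneg a0)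
    rw [add_right_comm] at h3
    simp only [Q]
    linarith
  have Q_add : ∀ f ∈ V, ∀ g ∈ V, Q (f + g) = Q f + Q g := by
    intro f hf g hg
    have h2 : e (‖f‖ + ‖g‖) = e ‖f‖ + e ‖g‖ := add_smul _ _ _
    rw [Q_eq (add_mem hf hg) (norm_add_le f g), h2,
      p_add (e_mem _) (e_nonneg (norm_nonneg f)) (e_nonneg (norm_nonneg g)), add_add_add_comm,
      p_add (add_mem hf (e_mem _)) (nonneg_add_norm_smul_one f le_rfl)
        (nonneg_add_norm_smul_one g le_rfl)]
    simp only [Q]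
    ring
  have Q_bound : ∀ f, ‖Q f‖ ≤ 2 * C * ‖f‖ := by
    intro f
    have h2 := p_nonneg (nonneg_add_norm_smul_one f le_rfl)
    have h3 := p_nonneg (e_nonneg (norm_nonneg f))
    have h4 := (p_le (nonneg_add_norm_smul_one f le_rfl)).trans
      (mul_le_mul_of_nonneg_left
        ((norm_add_le _ _).trans (add_le_add_right (e_norm (norm_nonneg f)) _)) hC)
    have h5 := (p_le (e_nonneg (norm_nonneg f))).trans
      (mul_le_mul_of_nonneg_left (e_norm (norm_nonneg f)) hC)
    have h6 : 0 ≤ C * ‖f‖ := by positivity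
    have h7 : Q f = p (f + ‖f‖ • 1) - p (e ‖f‖) := rfl
    rw [Real.norm_eq_abs, abs_le, h7]
    constructor <;> linarith
  -- A bounded additive map is continuous, hence real-linear, so homogeneity comes for free.
  let R : V →+ ℝ := AddMonoidHom.mk' (fun f => Q f.1) fun f g => Q_add _ f.2 _ g.2
  refine ⟨(R.toRealLinearMap
    (AddMonoidHomClass.continuous_of_bound R _ fun f => Q_bound f.1)).toLinearMap, fun f hf => ?_⟩
  have : Q f.1 = p f.1 := by
    simp only [Q]
    rw [p_add f.2 hf (e_nonneg (norm_nonneg _)), add_sub_cancel_right]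
  change IsLUB _ (Q f.1)
  rw [this]
  exact isLUB_csSup (dominatedValues_nonempty u hf) (bddAbove_dominatedValues hC hu _)

end PositivePart

/-! ### An invariant mean on the functions with norm-continuous orbit -/

section InvariantMean

open scoped BoundedContinuousFunction

variable {G : Type u} [Group G] [TopologicalSpace G] [IsTopologicalGroup G]

/-- A left-invariant mean on the real functions with norm-continuous orbits. -/
structure IsUniformMean (P : uniformlyContinuousSubmodule G ℝ →ₗ[ℝ] ℝ) : Prop where
  map_one : ∀ h, P ⟨1, h⟩ = 1
  nonneg : ∀ f : uniformlyContinuousSubmodule G ℝ, (∀ x, 0 ≤ f.1 x) → 0 ≤ P f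
  map_leftShift : ∀ (s : G) f (hf : f ∈ uniformlyContinuousSubmodule G ℝ),
    P ⟨leftShift s f, leftShift_mem_uniformlyContinuousSubmodule s hf⟩ = P ⟨f, hf⟩

/-- Real functions with norm-continuous orbits, as complex functions. -/
noncomputable def uniformOfReal :
    uniformlyContinuousSubmodule G ℝ →L[ℝ] uniformlyContinuousSubmodule G ℂ :=
  LinearMap.mkContinuous
    { toFun := fun f => ⟨Complex.ofRealCLM.compLeftContinuousBounded G f.1,
        ((Complex.ofRealCLM.compLeftContinuousBounded G).continuous.comp f.2 :)⟩
      map_add' := fun f g => by ext x; simp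
      map_smul' := fun c f => by ext x; simp } 1 fun f => by
    rw [one_mul]
    refine (BoundedContinuousFunction.norm_le (norm_nonneg _)).2 fun x => ?_
    simpa using f.1.norm_coe_le_norm x

/-- The modulus of an invariant functional is invariant because translation carries the functions
dominated by `f` onto those dominated by its translate. Its value at 1 is at least that of the
functional, so it can be normalised. -/
theorem BoundedOrbitsFixedPointProperty.exists_isUniformMean
    (H : BoundedOrbitsFixedPointProperty.{u, v} G) :
    ∃ P : uniformlyContinuousSubmodule G ℝ →ₗ[ℝ] ℝ, IsUniformMean P := by
  obtain ⟨m, m_one, m_shift⟩ := H.exists_invariant_functional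
  let w : StrongDual ℝ (uniformlyContinuousSubmodule G ℝ) :=
    Complex.reCLM.comp ((m.restrictScalars ℝ).comp uniformOfReal)
  let u : uniformlyContinuousSubmodule G ℝ →ₗ[ℝ] ℝ := w.toLinearMap
  have one_mem := one_mem_uniformlyContinuousSubmodule (G := G) (𝕜 := ℝ)
  have u_one : u ⟨1, one_mem⟩ = 1 := by
    have h : uniformOfReal ⟨1, one_mem⟩ = ⟨1, one_mem_uniformlyContinuousSubmodule (G := G)⟩ := by
      ext x; simp [uniformOfReal]
    simp [u, w, h, m_one]
  have u_shift : ∀ (s : G) f (hf : f ∈ uniformlyContinuousSubmodule G ℝ),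
      u ⟨leftShift s f, leftShift_mem_uniformlyContinuousSubmodule s hf⟩ = u ⟨f, hf⟩ :=
    fun s f hf => congrArg Complex.re (m_shift s _ (uniformOfReal ⟨f, hf⟩).2)
  obtain ⟨P, hP⟩ := exists_isLUB_dominatedValues
    (fun _ => abs_mem_uniformlyContinuousSubmodule) one_mem (u := u)
    (norm_nonneg w) w.le_opNorm
  have P_nonneg : ∀ f : uniformlyContinuousSubmodule G ℝ, (∀ x, 0 ≤ f.1 x) → 0 ≤ P f :=
    fun f hf => (hP f hf).1 ⟨0, fun x => by simpa using hf x, map_zero u⟩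
  have P_one : 1 ≤ P ⟨1, one_mem⟩ :=
    (hP ⟨1, one_mem⟩ fun _ => zero_le_one).1 ⟨⟨1, one_mem⟩, fun x => by simp, u_one⟩
  have shift_subset : ∀ (s : G) (f : G →ᵇ ℝ),
      dominatedValues u f ⊆ dominatedValues u (leftShift s f) := by
    rintro s f _ ⟨g, hg, rfl⟩
    exact ⟨⟨leftShift s g.1, leftShift_mem_uniformlyContinuousSubmodule s g.2⟩,
      fun x => hg (s * x), u_shift s g.1 g.2⟩
  have P_shift_nonneg : ∀ (s : G) f (hf : f ∈ uniformlyContinuousSubmodule G ℝ), (∀ x, 0 ≤ f x) →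
      P ⟨leftShift s f, leftShift_mem_uniformlyContinuousSubmodule s hf⟩ = P ⟨f, hf⟩ := by
    intro s f hf h0
    have h : dominatedValues u (leftShift s f) = dominatedValues u f := by
      refine Set.Subset.antisymm ?_ (shift_subset s f)
      have := shift_subset s⁻¹ (leftShift s f)
      rwa [← leftShift_mul, mul_inv_cancel, leftShift_one] at this
    have h2 := hP ⟨leftShift s f, leftShift_mem_uniformlyContinuousSubmodule s hf⟩ fun x => h0 _
    rw [h] at h2
    exact h2.unique (hP ⟨f, hf⟩ h0)
  have P_shift : ∀ (s : G) f (hf : f ∈ uniformlyContinuousSubmodule G ℝ),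
      P ⟨leftShift s f, leftShift_mem_uniformlyContinuousSubmodule s hf⟩ = P ⟨f, hf⟩ := by
    intro s f hf
    have h := P_shift_nonneg s (f + ‖f‖ • 1) (add_mem hf (Submodule.smul_mem _ _ one_mem))
      (nonneg_add_norm_smul_one f le_rfl)
    have h2 : P ⟨f + ‖f‖ • 1, add_mem hf (Submodule.smul_mem _ _ one_mem)⟩
        = P ⟨f, hf⟩ + ‖f‖ • P ⟨1, one_mem⟩ := by
      rw [← map_smul, ← map_add]; rfl
    have h3 : P ⟨leftShift s (f + ‖f‖ • 1), leftShift_mem_uniformlyContinuousSubmodule s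
          (add_mem hf (Submodule.smul_mem _ _ one_mem))⟩
        = P ⟨leftShift s f, leftShift_mem_uniformlyContinuousSubmodule s hf⟩
          + ‖f‖ • P ⟨1, one_mem⟩ := by
      rw [← map_smul, ← map_add]; rfl
    rw [h2, h3] at h
    exact add_right_cancel h
  have P_pos : 0 < P ⟨1, one_mem⟩ := zero_lt_one.trans_le P_one
  exact ⟨(P ⟨1, one_mem⟩)⁻¹ • P,
    ⟨fun h => inv_mul_cancel₀ P_pos.ne',
      fun f hf => mul_nonneg (inv_nonneg.2 P_pos.le) (P_nonneg f hf),
      fun s f hf => congrArg (fun y => (P ⟨1, one_mem⟩)⁻¹ * y) (P_shift s f hf)⟩⟩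

end InvariantMean

/-! ### The modular function and right Haar measure -/

section RightHaar

open Measure Topology
open scoped NNReal CompactlySupported

variable {G : Type u} [Group G] [TopologicalSpace G] [IsTopologicalGroup G]
  [LocallyCompactSpace G] [MeasurableSpace G] [BorelSpace G]

theorem map_mul_right_haar (g : G) :
    (haar : Measure G).map (· * g) = modularCharacterFun g • (haar : Measure G) := by
  have : ((haar : Measure G).map (· * g)).Regular := Regular.map (Homeomorph.mulRight g)
  rw [modularCharacterFun_eq_haarScalarFactor (haar : Measure G)]
  exact isMulLeftInvariant_eq_smul_of_regular _ _

theorem integral_haar_mul_right (φ : G → ℝ) (g : G) :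
    ∫ r, φ (r * g) ∂haar = modularCharacterFun g * ∫ r, φ r ∂haar := by
  have h : ∫ r, φ r ∂((haar : Measure G).map (· * g)) = ∫ r, φ (r * g) ∂haar :=
    (Homeomorph.mulRight g).measurableEmbedding.integral_map φ
  rw [← h, map_mul_right_haar, integral_smul_nnreal_measure]
  rfl

theorem quasiMeasurePreserving_mul_right_haar (g : G) :
    QuasiMeasurePreserving (· * g) (haar : Measure G) haar :=
  ⟨measurable_mul_const g, by rw [map_mul_right_haar]; exact smul_absolutelyContinuous⟩

/-- For a bump function `f`, the integral of `r ↦ f (r * x)` is the modular function at `x` times a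
positive constant, and it depends continuously on `x`. -/
theorem continuous_modularCharacterFun : Continuous (modularCharacterFun : G → ℝ≥0) := by
  obtain ⟨f, f_comp, f_nonneg, f_one⟩ := exists_continuous_nonneg_pos (1 : G)
  have hpos : 0 < ∫ r, f r ∂haar :=
    f.continuous.integral_pos_of_hasCompactSupport_nonneg_nonzero f_comp f_nonneg f_one
  have h : Continuous fun x => ∫ y, f (y⁻¹ * x) ∂(haar : Measure G).inv :=
    continuous_integral_apply_inv_mul f.continuous f_comp
  have h2 : ∀ x, ∫ y, f (y⁻¹ * x) ∂(haar : Measure G).inv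
      = modularCharacterFun x * ∫ r, f r ∂haar := fun x => by
    rw [← integral_haar_mul_right]
    refine ((Homeomorph.inv G).measurableEmbedding.integral_map _).trans ?_
    simp
  simp only [h2] at h
  have h3 := h.div_const (∫ r, f r ∂haar)
  simp only [mul_div_cancel_right₀ _ hpos.ne'] at h3
  exact NNReal.isEmbedding_coe.continuous_iff.2 h3

variable (G) in
/-- A right Haar measure, given by its density with respect to left Haar measure. -/
noncomputable def rightHaar : Measure G :=
  haar.withDensity fun r => (modularCharacterFun r : ℝ≥0∞)

instance : IsLocallyFiniteMeasure (rightHaar G) :=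
  IsLocallyFiniteMeasure.withDensity_coe continuous_modularCharacterFun

theorem integral_rightHaar (φ : G → ℝ) :
    ∫ r, φ r ∂rightHaar G = ∫ r, modularCharacterFun r * φ r ∂haar :=
  integral_withDensity_eq_integral_smul continuous_modularCharacterFun.measurable φ

theorem integral_rightHaar_mul_right (φ : G → ℝ) (s : G) :
    ∫ r, φ (r * s) ∂rightHaar G = ∫ r, φ r ∂rightHaar G := by
  have hs : (modularCharacterFun s : ℝ) ≠ 0 := by exact_mod_cast (modularCharacterFun_pos s).ne'
  have h := integral_haar_mul_right (fun r => modularCharacterFun r * φ r) s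
  simp only [modularCharacterFun_map_mul, NNReal.coe_mul,
    mul_right_comm _ (modularCharacterFun s : ℝ),
    integral_mul_const] at h
  rw [mul_comm] at h
  rw [integral_rightHaar, integral_rightHaar]
  exact mul_left_cancel₀ hs h

theorem integral_rightHaar_mul_left (φ : G → ℝ) (s : G) :
    modularCharacterFun s * ∫ r, φ (s * r) ∂rightHaar G = ∫ r, φ r ∂rightHaar G := by
  rw [integral_rightHaar, integral_rightHaar, ← integral_const_mul,
    ← integral_mul_left_eq_self (fun r => modularCharacterFun r * φ r) s]
  simp only [modularCharacterFun_map_mul, NNReal.coe_mul, mul_assoc]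

/-- This holds for every `t`, so convolutions of classes in `L^∞` are well defined pointwise. -/
theorem ae_rightHaar_mul_right {p : G → Prop} (h : ∀ᵐ r ∂(haar : Measure G), p r) (t : G) :
    ∀ᵐ r ∂rightHaar G, p (r * t) :=
  (withDensity_absolutelyContinuous _ _).ae_le
    ((quasiMeasurePreserving_mul_right_haar t).ae h)

end RightHaar

/-! ### Uniqueness of Haar measure for positive functionals -/

section LeftInvariantFunctionals

open Measure Topology
open scoped NNReal CompactlySupported

variable {G : Type u} [Group G] [TopologicalSpace G] [IsTopologicalGroup G]

/-- The translate `k (s * ·)` of a compactly supported continuous function. -/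
def ccLeftShift (s : G) (k : C_c(G, ℝ)) : C_c(G, ℝ) :=
  ⟨⟨fun r => k (s * r), k.continuous.comp (continuous_const_mul s)⟩,
    k.hasCompactSupport.comp_homeomorph (Homeomorph.mulLeft s)⟩

/-- The translate `k (· * s)` of a compactly supported continuous function. -/
def ccRightShift (s : G) (k : C_c(G, ℝ)) : C_c(G, ℝ) :=
  ⟨⟨fun r => k (r * s), k.continuous.comp (continuous_mul_const s)⟩,
    k.hasCompactSupport.comp_homeomorph (Homeomorph.mulRight s)⟩

@[simp]
theorem ccLeftShift_apply (s : G) (k : C_c(G, ℝ)) (r : G) : ccLeftShift s k r = k (s * r) := rfl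

@[simp]
theorem ccRightShift_apply (s : G) (k : C_c(G, ℝ)) (r : G) : ccRightShift s k r = k (r * s) := rfl

variable [LocallyCompactSpace G] [T2Space G] [MeasurableSpace G] [BorelSpace G]

theorem exists_eq_smul_integral_of_ccLeftShift {Λ : C_c(G, ℝ) →ₗ[ℝ] ℝ}
    (hΛ : ∀ k, (∀ r, 0 ≤ k r) → 0 ≤ Λ k) (hs : ∀ s k, Λ (ccLeftShift s k) = Λ k) :
    ∃ c : ℝ, ∀ k, Λ k = c * ∫ r, k r ∂haar := by
  let L : C_c(G, ℝ) →ₚ[ℝ] ℝ := PositiveLinearMap.mk₀ Λ fun k hk => hΛ k hk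
  let ν := RealRMK.rieszMeasure L
  have hν : ∀ k : C_c(G, ℝ), ∫ r, k r ∂ν = Λ k := RealRMK.integral_rieszMeasure L
  have : IsMulLeftInvariant ν := ⟨fun s => by
    have : (ν.map (s * ·)).Regular := Regular.map (Homeomorph.mulLeft s)
    refine ext_of_integral_eq_on_compactlySupported fun k => ?_
    rw [hν, ← hs s k, ← hν]
    exact (Homeomorph.mulLeft s).measurableEmbedding.integral_map _⟩
  obtain ⟨c, hc⟩ := exists_integral_isMulLeftInvariant_eq_smul_of_hasCompactSupport ν haar
  refine ⟨c, fun k => ?_⟩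
  rw [← hν, hc k k.continuous k.hasCompactSupport, integral_smul_nnreal_measure]
  rfl

end LeftInvariantFunctionals

/-! ### Smoothing `L^∞` functions by convolution -/

section Convolution

open Measure Topology
open scoped NNReal CompactlySupported BoundedContinuousFunction Pointwise

variable {G : Type u} [Group G] [TopologicalSpace G] [IsTopologicalGroup G]
  [LocallyCompactSpace G] [MeasurableSpace G] [BorelSpace G]

theorem integrable_inv_rightHaar (k : C_c(G, ℝ)) : Integrable (fun r => k r⁻¹) (rightHaar G) :=
  (k.continuous.comp continuous_inv).integrable_of_hasCompactSupport
    (k.hasCompactSupport.comp_homeomorph (Homeomorph.inv G))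

variable (G) in
/-- The functional `k ↦ ∫ k (r⁻¹) dr` for the right Haar measure. -/
noncomputable def invIntegral : C_c(G, ℝ) →ₗ[ℝ] ℝ where
  toFun k := ∫ r, k r⁻¹ ∂rightHaar G
  map_add' k l := integral_add (integrable_inv_rightHaar k) (integrable_inv_rightHaar l)
  map_smul' c _ := integral_const_mul c _

theorem invIntegral_apply (k : C_c(G, ℝ)) : invIntegral G k = ∫ r, k r⁻¹ ∂rightHaar G := rfl

theorem invIntegral_nonneg (k : C_c(G, ℝ)) (hk : ∀ r, 0 ≤ k r) : 0 ≤ invIntegral G k :=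
  integral_nonneg fun r => hk r⁻¹

theorem invIntegral_ccLeftShift (s : G) (k : C_c(G, ℝ)) :
    invIntegral G (ccLeftShift s k) = invIntegral G k := by
  rw [invIntegral_apply, ← integral_rightHaar_mul_right _ s]
  simp [invIntegral_apply]

theorem invIntegral_ccRightShift (s : G) (k : C_c(G, ℝ)) :
    invIntegral G (ccRightShift s k) = modularCharacterFun s * invIntegral G k := by
  rw [invIntegral_apply, ← integral_rightHaar_mul_left _ s]
  simp [invIntegral_apply]

theorem exists_invIntegral_eq_one :
    ∃ k : C_c(G, ℝ), (∀ r, 0 ≤ k r) ∧ invIntegral G k = 1 := by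
  obtain ⟨f, f_comp, f_nonneg, f_one⟩ := exists_continuous_nonneg_pos (1 : G)
  let k : C_c(G, ℝ) := ⟨f, f_comp⟩
  have hpos : 0 < invIntegral G k := by
    rw [invIntegral_apply, integral_rightHaar]
    refine Continuous.integral_pos_of_hasCompactSupport_nonneg_nonzero (x := 1) ?_ ?_ ?_ ?_
    · exact (NNReal.continuous_coe.comp continuous_modularCharacterFun).mul
        (f.continuous.comp continuous_inv)
    · exact (f_comp.comp_homeomorph (Homeomorph.inv G)).mul_left
    · exact fun r => mul_nonneg NNReal.zero_le_coe (f_nonneg _)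
    · simpa [k, modularCharacterFun_map_one] using f_one
  refine ⟨(invIntegral G k)⁻¹ • k, fun r => mul_nonneg (inv_nonneg.2 hpos.le) (f_nonneg r), ?_⟩
  rw [map_smul, smul_eq_mul, inv_mul_cancel₀ hpos.ne']

/-- For `s` in a compact neighbourhood `U` of the identity, all integrands are supported in the
fixed compact set `(tsupport k)⁻¹ * U`. -/
theorem tendsto_integral_abs_ccLeftShift_sub (k : C_c(G, ℝ)) :
    Filter.Tendsto (fun s => ∫ r, |(ccLeftShift s k - k) r⁻¹| ∂rightHaar G) (𝓝 1) (𝓝 0) := by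
  obtain ⟨U, hU, hU1⟩ := exists_compact_mem_nhds (1 : G)
  have hK : IsCompact ((tsupport k)⁻¹ * U) := (IsCompact.inv k.hasCompactSupport).mul hU
  have hsupp : ∀ s ∈ U, ∀ r ∉ (tsupport k)⁻¹ * U, k (s * r⁻¹) = 0 := fun s hs r hr => by
    by_contra h
    refine hr ⟨r * s⁻¹, ?_, s, hs, by simp⟩
    simpa using subset_tsupport k h
  have h : ContinuousOn (fun s => ∫ r, |(ccLeftShift s k - k) r⁻¹| ∂rightHaar G) U := by
    refine continuousOn_integral_of_compact_support hK (Continuous.continuousOn ?_) ?_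
    · have : Continuous fun p : G × G => |k (p.1 * p.2⁻¹) - k p.2⁻¹| := by fun_prop
      exact this
    · intro s r hs hr
      have h1 := hsupp s hs r hr
      have h2 := hsupp 1 (mem_of_mem_nhds hU1) r hr
      rw [one_mul] at h2
      simp [h1, h2]
  have h1 := (h.continuousAt hU1).tendsto
  simpa using h1

theorem aestronglyMeasurable_mul_right (f : Lp ℂ ∞ (haar : Measure G)) (t : G) :
    AEStronglyMeasurable (fun r => (f (r * t)).re) (rightHaar G) :=
  (Complex.measurable_re.comp ((Lp.stronglyMeasurable f).measurable.comp
    (measurable_mul_const t))).aestronglyMeasurable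

theorem ae_abs_re_mul_right_le (f : Lp ℂ ∞ (haar : Measure G)) (t : G) :
    ∀ᵐ r ∂rightHaar G, ‖(f (r * t)).re‖ ≤ ‖f‖ := by
  have h : ∀ᵐ r ∂(haar : Measure G), ‖f r‖ ≤ ‖f‖ := by
    filter_upwards [ae_le_eLpNormEssSup (f := f) (μ := haar)] with r hr
    rw [Lp.norm_def, eLpNorm_exponent_top, ← toReal_enorm]
    exact ENNReal.toReal_mono (by simpa using Lp.eLpNorm_ne_top f) hr
  filter_upwards [ae_rightHaar_mul_right h t] with r hr
  exact (Complex.abs_re_le_norm _).trans hr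

theorem norm_le_of_ae_bound_haar {f : Lp ℂ ∞ (haar : Measure G)} {C : ℝ} (hC : 0 ≤ C)
    (h : ∀ᵐ r ∂(haar : Measure G), ‖f r‖ ≤ C) : ‖f‖ ≤ C := by
  rw [Lp.norm_def, eLpNorm_exponent_top]
  exact ENNReal.toReal_le_of_le_ofReal hC (eLpNormEssSup_le_of_ae_bound h)

theorem integrable_haarConv (f : Lp ℂ ∞ (haar : Measure G)) (k : C_c(G, ℝ)) (t : G) :
    Integrable (fun r => k r⁻¹ * (f (r * t)).re) (rightHaar G) :=
  (integrable_inv_rightHaar k).mul_bdd (aestronglyMeasurable_mul_right f t)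
    (ae_abs_re_mul_right_le f t)

/-- The convolution `t ↦ ∫ k (r⁻¹) Re f (r t) dr`, as a bare function. -/
noncomputable def haarConvFun (f : Lp ℂ ∞ (haar : Measure G)) (k : C_c(G, ℝ)) (t : G) : ℝ :=
  ∫ r, k r⁻¹ * (f (r * t)).re ∂rightHaar G

/-- Right invariance moves the translation onto the kernel, where it is `L¹`-continuous; this is why
convolutions have norm-continuous orbits. -/
theorem haarConvFun_mul_left (f : Lp ℂ ∞ (haar : Measure G)) (k : C_c(G, ℝ)) (s t : G) :
    haarConvFun f k (s * t) = haarConvFun f (ccLeftShift s k) t := by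
  rw [haarConvFun, haarConvFun,
    ← integral_rightHaar_mul_right (fun r => ccLeftShift s k r⁻¹ * (f (r * t)).re) s]
  simp [mul_assoc]

theorem haarConvFun_add_right (f : Lp ℂ ∞ (haar : Measure G)) (k l : C_c(G, ℝ)) (t : G) :
    haarConvFun f (k + l) t = haarConvFun f k t + haarConvFun f l t := by
  rw [haarConvFun, haarConvFun, haarConvFun,
    ← integral_add (integrable_haarConv f k t) (integrable_haarConv f l t)]
  simp [add_mul]

theorem haarConvFun_smul_right (f : Lp ℂ ∞ (haar : Measure G)) (c : ℝ) (k : C_c(G, ℝ)) (t : G) :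
    haarConvFun f (c • k) t = c * haarConvFun f k t := by
  rw [haarConvFun, haarConvFun, ← integral_const_mul]
  simp [mul_assoc]

theorem haarConvFun_sub_right (f : Lp ℂ ∞ (haar : Measure G)) (k l : C_c(G, ℝ)) (t : G) :
    haarConvFun f (k - l) t = haarConvFun f k t - haarConvFun f l t := by
  rw [haarConvFun, haarConvFun, haarConvFun,
    ← integral_sub (integrable_haarConv f k t) (integrable_haarConv f l t)]
  simp [sub_mul]

theorem abs_haarConvFun_le (f : Lp ℂ ∞ (haar : Measure G)) (k : C_c(G, ℝ)) (t : G) :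
    |haarConvFun f k t| ≤ ‖f‖ * ∫ r, |k r⁻¹| ∂rightHaar G := by
  rw [← integral_const_mul, ← Real.norm_eq_abs]
  refine norm_integral_le_of_norm_le ((integrable_inv_rightHaar k).abs.const_mul _) ?_
  filter_upwards [ae_abs_re_mul_right_le f t] with r hr
  rw [norm_mul, mul_comm]
  exact mul_le_mul_of_nonneg_right hr (abs_nonneg _)

theorem abs_haarConvFun_mul_left_sub_le (f : Lp ℂ ∞ (haar : Measure G)) (k : C_c(G, ℝ)) (s t : G) :
    |haarConvFun f k (s * t) - haarConvFun f k t|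
      ≤ ‖f‖ * ∫ r, |(ccLeftShift s k - k) r⁻¹| ∂rightHaar G := by
  rw [haarConvFun_mul_left, ← haarConvFun_sub_right]
  exact abs_haarConvFun_le _ _ _

theorem continuous_haarConvFun (f : Lp ℂ ∞ (haar : Measure G)) (k : C_c(G, ℝ)) :
    Continuous (haarConvFun f k) := by
  refine continuous_iff_continuousAt.2 fun t => tendsto_iff_norm_sub_tendsto_zero.2 ?_
  have h : Filter.Tendsto (fun x => x * t⁻¹) (𝓝 t) (𝓝 1) :=
    (continuous_mul_const t⁻¹).tendsto' _ _ (mul_inv_cancel t)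
  have h2 := ((tendsto_integral_abs_ccLeftShift_sub k).comp h).const_mul ‖f‖
  rw [mul_zero] at h2
  refine squeeze_zero (fun _ => norm_nonneg _) (fun x => ?_) h2
  have h3 := abs_haarConvFun_mul_left_sub_le f k (x * t⁻¹) t
  rwa [inv_mul_cancel_right] at h3

/-- The convolution `t ↦ ∫ k (r⁻¹) Re f (r t) dr`, which has a norm-continuous orbit. -/
noncomputable def haarConv (f : Lp ℂ ∞ (haar : Measure G)) (k : C_c(G, ℝ)) :
    uniformlyContinuousSubmodule G ℝ :=
  ⟨BoundedContinuousFunction.ofNormedAddCommGroup (haarConvFun f k) (continuous_haarConvFun f k) _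
    (abs_haarConvFun_le f k), by
    have h2 := (tendsto_integral_abs_ccLeftShift_sub k).const_mul ‖f‖
    rw [mul_zero] at h2
    refine mem_uniformlyContinuousSubmodule_of_norm_shift_sub_le h2 fun s => ?_
    refine (BoundedContinuousFunction.norm_le ?_).2 fun t => abs_haarConvFun_mul_left_sub_le f k s t
    exact mul_nonneg (norm_nonneg _) (integral_nonneg fun _ => abs_nonneg _)⟩

theorem norm_haarConv_le (f : Lp ℂ ∞ (haar : Measure G)) {k : C_c(G, ℝ)} (hk : ∀ r, 0 ≤ k r) :
    ‖(haarConv f k).1‖ ≤ ‖f‖ * invIntegral G k := by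
  refine (BoundedContinuousFunction.norm_le
    (mul_nonneg (norm_nonneg _) (invIntegral_nonneg k hk))).2 fun t => ?_
  have h := abs_haarConvFun_le f k t
  simp only [abs_of_nonneg (hk _)] at h
  exact h

theorem haarConv_ccLeftShift (f : Lp ℂ ∞ (haar : Measure G)) (k : C_c(G, ℝ)) (s : G) :
    haarConv f (ccLeftShift s k)
      = ⟨leftShift s (haarConv f k).1,
          leftShift_mem_uniformlyContinuousSubmodule s (haarConv f k).2⟩ := by
  ext t
  exact (haarConvFun_mul_left f k s t).symm

theorem haarConv_add_left (f g : Lp ℂ ∞ (haar : Measure G)) (k : C_c(G, ℝ)) :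
    haarConv (f + g) k = haarConv f k + haarConv g k := by
  ext t
  change haarConvFun _ _ _ = haarConvFun _ _ _ + haarConvFun _ _ _
  rw [haarConvFun, haarConvFun, haarConvFun,
    ← integral_add (integrable_haarConv f k t) (integrable_haarConv g k t)]
  refine integral_congr_ae ?_
  filter_upwards [ae_rightHaar_mul_right (Lp.coeFn_add f g) t] with r hr
  rw [hr, Pi.add_apply, Complex.add_re, mul_add]

theorem haarConv_smul_left (c : ℝ) (f : Lp ℂ ∞ (haar : Measure G)) (k : C_c(G, ℝ)) :
    haarConv (c • f) k = c • haarConv f k := by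
  ext t
  change haarConvFun _ _ _ = c * haarConvFun _ _ _
  rw [haarConvFun, haarConvFun, ← integral_const_mul]
  refine integral_congr_ae ?_
  filter_upwards [ae_rightHaar_mul_right (Lp.coeFn_smul c f) t] with r hr
  rw [hr, Pi.smul_apply, Complex.smul_re, smul_eq_mul]
  ring

/-- Substituting `u * r` for `r` in a right Haar integral costs the modular factor. -/
theorem haarConv_smul_leftTranslate (u : G) (f : Lp ℂ ∞ (haar : Measure G)) (k : C_c(G, ℝ)) :
    (modularCharacterFun u : ℝ) • haarConv (leftTranslate u f) k
      = haarConv f (ccRightShift u k) := by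
  ext t
  change _ * haarConvFun _ _ _ = haarConvFun _ _ _
  rw [haarConvFun, haarConvFun,
    ← integral_rightHaar_mul_left (fun r => ccRightShift u k r⁻¹ * (f (r * t)).re) u]
  refine congrArg (fun y : ℝ => modularCharacterFun u * y) (integral_congr_ae ?_)
  filter_upwards [ae_rightHaar_mul_right (Lp.coeFn_compMeasurePreserving f
    (measurePreserving_mul_left haar u)) t] with r hr
  simp only [leftTranslate, hr]
  simp [mul_assoc]

theorem haarConv_oneLinfty (k : C_c(G, ℝ)) :
    haarConv (oneLinfty G) k = invIntegral G k • ⟨1, one_mem_uniformlyContinuousSubmodule⟩ := by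
  ext t
  change haarConvFun _ _ _ = invIntegral G k * 1
  rw [haarConvFun, mul_one, invIntegral_apply]
  refine integral_congr_ae (G := ℝ) ?_
  filter_upwards [ae_rightHaar_mul_right (memLp_top_const (1 : ℂ)).coeFn_toLp t] with r hr
  rw [oneLinfty, hr, Complex.one_re, mul_one]

theorem haarConv_I_smul_oneLinfty (k : C_c(G, ℝ)) : haarConv (Complex.I • oneLinfty G) k = 0 := by
  ext t
  change haarConvFun _ _ _ = 0
  refine integral_eq_zero_of_ae ?_
  filter_upwards [ae_rightHaar_mul_right (memLp_top_const (1 : ℂ)).coeFn_toLp t,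
    ae_rightHaar_mul_right (Lp.coeFn_smul Complex.I (oneLinfty G)) t] with r hr hr'
  rw [hr', Pi.smul_apply, oneLinfty, hr]
  simp

end Convolution

/-! ### From uniform means to means on `L^∞` -/

section Means

open Measure
open scoped CompactlySupported

variable {G : Type u} [Group G] [TopologicalSpace G] [IsTopologicalGroup G]

theorem IsUniformMean.abs_le {P : uniformlyContinuousSubmodule G ℝ →ₗ[ℝ] ℝ}
    (hP : IsUniformMean P) (f : uniformlyContinuousSubmodule G ℝ) : |P f| ≤ ‖f.1‖ := by
  let e : uniformlyContinuousSubmodule G ℝ := ⟨1, one_mem_uniformlyContinuousSubmodule⟩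
  have he : P e = 1 := hP.map_one _
  have h : ∀ g : uniformlyContinuousSubmodule G ℝ, P (g + ‖g.1‖ • e) = P g + ‖g.1‖ := fun g => by
    rw [map_add, map_smul, he, smul_eq_mul, mul_one]
  have h1 := hP.nonneg (f + ‖f.1‖ • e) (nonneg_add_norm_smul_one f.1 le_rfl)
  have h2 := hP.nonneg (-f + ‖(-f).1‖ • e) (nonneg_add_norm_smul_one (-f).1 le_rfl)
  rw [h] at h1 h2
  have h3 : ‖(-f).1‖ = ‖f.1‖ := norm_neg f.1
  rw [h3, map_neg] at h2
  exact _root_.abs_le.2 ⟨by linarith, by linarith⟩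

variable [LocallyCompactSpace G] [MeasurableSpace G] [BorelSpace G]

theorem IsUniformMean.exists_haarConv_eq_smul_invIntegral [T2Space G]
    {P : uniformlyContinuousSubmodule G ℝ →ₗ[ℝ] ℝ} (hP : IsUniformMean P)
    (f : Lp ℂ ∞ (haar : Measure G)) : ∃ c : ℝ, ∀ k, P (haarConv f k) = c * invIntegral G k := by
  let Φ : C_c(G, ℝ) →ₗ[ℝ] ℝ :=
    { toFun := fun k => P (haarConv f k)
      map_add' := fun k l => by
        rw [← map_add]
        exact congrArg P (Subtype.ext (BoundedContinuousFunction.ext (haarConvFun_add_right f k l)))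
      map_smul' := fun c k => by
        rw [RingHom.id_apply, ← map_smul]
        exact congrArg P
          (Subtype.ext (BoundedContinuousFunction.ext (haarConvFun_smul_right f c k))) }
  -- `Φ` need not be positive, but `|Φ k| ≤ ‖f‖ * invIntegral G k` for `k ≥ 0`, so adding this
  -- invariant multiple makes it so.
  obtain ⟨a, ha⟩ := exists_eq_smul_integral_of_ccLeftShift (Λ := Φ + ‖f‖ • invIntegral G)
    (fun k hk => by
      have h := (_root_.abs_le.1 ((hP.abs_le (haarConv f k)).trans (norm_haarConv_le f hk))).1
      change 0 ≤ P (haarConv f k) + ‖f‖ * invIntegral G k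
      linarith)
    (fun s k => by
      change P (haarConv f _) + ‖f‖ * invIntegral G _ = P (haarConv f k) + ‖f‖ * invIntegral G k
      rw [invIntegral_ccLeftShift, haarConv_ccLeftShift, hP.map_leftShift])
  obtain ⟨b, hb⟩ := exists_eq_smul_integral_of_ccLeftShift (Λ := invIntegral G)
    invIntegral_nonneg invIntegral_ccLeftShift
  obtain ⟨k₀, -, hk₀⟩ := exists_invIntegral_eq_one (G := G)
  have hb0 : b ≠ 0 := by
    rintro rfl
    have := hb k₀
    rw [hk₀, zero_mul] at this
    exact one_ne_zero this
  refine ⟨a * b⁻¹ - ‖f‖, fun k => ?_⟩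
  have h1 : P (haarConv f k) + ‖f‖ * invIntegral G k = _ := ha k
  have h2 : ∫ r, k r ∂haar = b⁻¹ * invIntegral G k := by rw [hb, inv_mul_cancel_left₀ hb0]
  rw [h2] at h1
  linarith

/-- An invariant mean on the functions with norm-continuous orbits yields, by smoothing, an
invariant mean on `L^∞`. -/
theorem IsUniformMean.isAmenableGroup [T2Space G]
    {P : uniformlyContinuousSubmodule G ℝ →ₗ[ℝ] ℝ} (hP : IsUniformMean P) :
    IsAmenableGroup G := by
  obtain ⟨k, hk, hk1⟩ := exists_invIntegral_eq_one (G := G)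
  let M : StrongDual ℝ (Lp ℂ ∞ (haar : Measure G)) := LinearMap.mkContinuous
    { toFun := fun f => P (haarConv f k)
      map_add' := fun f g => by rw [haarConv_add_left, map_add]
      map_smul' := fun c f => by rw [haarConv_smul_left, map_smul, RingHom.id_apply] } 1 fun f => by
    have h := (hP.abs_le (haarConv f k)).trans (norm_haarConv_le f hk)
    rwa [hk1, mul_one, ← one_mul ‖f‖] at h
  have hM : ‖M‖ ≤ 1 := LinearMap.mkContinuous_norm_le _ zero_le_one _
  have M_apply : ∀ f, M f = P (haarConv f k) := fun _ => rfl
  have M_one : M (oneLinfty G) = 1 := by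
    rw [M_apply, haarConv_oneLinfty, hk1, one_smul, hP.map_one]
  have M_I : M (Complex.I • oneLinfty G) = 0 := by
    rw [M_apply, haarConv_I_smul_oneLinfty, map_zero]
  -- The modular factor from translating `f` equals the one by which right translation scales the
  -- mass of `k`.
  have M_shift : ∀ s f, M (leftTranslate s f) = M f := fun s f => by
    obtain ⟨c, hc⟩ := hP.exists_haarConv_eq_smul_invIntegral f
    have hs : (modularCharacterFun s : ℝ) ≠ 0 := by
      exact_mod_cast (modularCharacterFun_pos s).ne'
    have h := congrArg P (haarConv_smul_leftTranslate s f k)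
    rw [map_smul, hc, invIntegral_ccRightShift, smul_eq_mul, mul_left_comm, ← hc] at h
    exact mul_left_cancel₀ hs h
  -- `M` sees only real parts; its complexification `f ↦ M f - i M (i f)` has the same norm.
  have m_one : M.extendRCLike (𝕜 := ℂ) (oneLinfty G) = 1 := by
    rw [StrongDual.extendRCLike_apply]
    change ((M (oneLinfty G) : ℝ) : ℂ) - Complex.I * ((M (Complex.I • oneLinfty G) : ℝ) : ℂ) = 1
    rw [M_one, M_I]
    simp
  have norm_one_le : ‖oneLinfty G‖ ≤ 1 := by
    refine norm_le_of_ae_bound_haar zero_le_one ?_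
    filter_upwards [(memLp_top_const (1 : ℂ)).coeFn_toLp (μ := (haar : Measure G))] with r hr
    rw [oneLinfty, hr, norm_one]
  refine ⟨M.extendRCLike, le_antisymm ?_ ?_, m_one, fun s f => ?_⟩
  · rwa [StrongDual.norm_extendRCLike]
  · have h := (M.extendRCLike (𝕜 := ℂ)).le_opNorm (oneLinfty G)
    rw [m_one, norm_one] at h
    exact h.trans (mul_le_of_le_one_right (norm_nonneg _) norm_one_le)
  · have h : Complex.I • leftTranslate s f = leftTranslate s (Complex.I • f) :=
      ((Lp.compMeasurePreservingₗ ℂ _ (measurePreserving_mul_left haar s)).map_smul _ f).symm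
    rw [StrongDual.extendRCLike_apply, StrongDual.extendRCLike_apply]
    change ((M (leftTranslate s f) : ℝ) : ℂ)
      - Complex.I * ((M (Complex.I • leftTranslate s f) : ℝ) : ℂ)
      = (M f : ℂ) - Complex.I * (M (Complex.I • f) : ℂ)
    rw [h, M_shift, M_shift]

end Means

/-! ### From an invariant mean to a fixed point -/

section FixedPoint

open Measure

variable {G : Type u} [Group G] [TopologicalSpace G] [IsTopologicalGroup G]
  [LocallyCompactSpace G] [MeasurableSpace G] [BorelSpace G]

/-- Averaging a bounded orbit against an invariant mean produces a fixed point. -/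
theorem IsLeftInvariantMean.exists_fixed_point
    {m : StrongDual ℂ (Lp ℂ ∞ (haar : Measure G))} (hm : IsLeftInvariantMean m)
    {E : Type v} [NormedAddCommGroup E] [NormedSpace ℂ E]
    {α : G → WeakDual ℂ E → WeakDual ℂ E} (hα : IsWeakStarAffineAction α)
    {φ : WeakDual ℂ E} (hφ : HasNormBoundedOrbit α φ) : ∃ ψ, ∀ t, α t ψ = ψ := by
  obtain ⟨C, hC⟩ := isBounded_iff_forall_norm_le.1 hφ
  have hbound : ∀ x t, ‖α t φ x‖ ≤ C * ‖x‖ := fun x t =>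
    (WeakDual.toStrongDual (α t φ)).le_of_opNorm_le (hC _ ⟨t, rfl⟩) x
  have hcont : ∀ x, Continuous fun t => α t φ x := fun x =>
    (WeakDual.eval_continuous x).comp (hα.continuous_orbit φ)
  have hmem : ∀ x, MemLp (fun t => α t φ x) ∞ (haar : Measure G) := fun x =>
    memLp_top_of_bound (hcont x).measurable.aestronglyMeasurable _
      (Filter.Eventually.of_forall (hbound x))
  let ψ : StrongDual ℂ E := LinearMap.mkContinuous
    { toFun := fun x => m ((hmem x).toLp _)
      map_add' := fun x y => by
        rw [← map_add, ← MemLp.toLp_add]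
        congr 2
        ext t
        exact map_add (WeakDual.toStrongDual (α t φ)) x y
      map_smul' := fun c x => by
        rw [RingHom.id_apply, ← map_smul, ← MemLp.toLp_const_smul]
        congr 2
        ext t
        exact map_smul (WeakDual.toStrongDual (α t φ)) c x } C fun x => by
    have h0 : 0 ≤ C * ‖x‖ := (norm_nonneg _).trans (hbound x 1)
    refine (m.le_opNorm _).trans ?_
    rw [hm.norm_eq_one, one_mul]
    refine norm_le_of_ae_bound_haar h0 ?_
    filter_upwards [(hmem x).coeFn_toLp] with t ht
    rw [ht]
    exact hbound x t
  have ψ_apply : ∀ x, ψ x = m ((hmem x).toLp _) := fun _ => rfl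
  refine ⟨StrongDual.toWeakDual ψ, fun s => DFunLike.ext _ _ fun x => ?_⟩
  obtain ⟨L, c, hL⟩ := hα.affine s
  have L_cont : Continuous L := by
    have h : (L : WeakDual ℂ E → WeakDual ℂ E) = fun χ => α s χ - c := by
      ext1 χ
      rw [hL, add_sub_cancel_right]
    rw [h]
    exact (hα.continuous_act s).sub continuous_const
  -- A weak*-continuous functional on the dual is evaluation at a vector of `E`. This lets `L` pass
  -- through the average, which is only defined pointwise on `E`.
  obtain ⟨y, hy⟩ : ∃ y, ∀ χ : WeakDual ℂ E, L χ x = χ y := by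
    let ev : StrongDual ℂ (WeakDual ℂ E) :=
      { toFun := fun χ => L χ x
        map_add' := fun χ η => by rw [map_add]; rfl
        map_smul' := fun a χ => by rw [map_smul]; rfl
        cont := (WeakDual.eval_continuous x).comp L_cont }
    obtain ⟨y, hy⟩ := LinearMap.dualEmbedding_surjective (topDualPairing ℂ E) ev
    exact ⟨y, fun χ => (DFunLike.congr_fun hy χ).symm⟩
  have h1 : ∀ χ : WeakDual ℂ E, α s χ x = χ y + c x := fun χ => by
    rw [← hy, hL]
    rfl
  rw [h1]
  have h2 : leftTranslate s ((hmem x).toLp _)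
      = (hmem y).toLp _ + c x • oneLinfty G := by
    rw [leftTranslate, Lp.toLp_compMeasurePreserving, oneLinfty, ← MemLp.toLp_const_smul,
      ← MemLp.toLp_add]
    congr 1
    ext t
    change α (s * t) φ x = α t φ y + c x • (1 : ℂ)
    rw [hα.mul_act, h1, smul_eq_mul, mul_one]
  have h3 := hm.map_leftTranslate s ((hmem x).toLp _)
  rw [h2, map_add, map_smul, hm.map_one, smul_eq_mul, mul_one] at h3
  exact h3

end FixedPoint

theorem mainTheorem5 (G : Type u) [Group G] [TopologicalSpace G] [IsTopologicalGroup G]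
    [LocallyCompactSpace G] [T2Space G] [MeasurableSpace G] [BorelSpace G] :
    (IsAmenableGroup G ↔
      ∀ (E : Type (max u v)) [NormedAddCommGroup E] [NormedSpace ℂ E] [CompleteSpace E]
        (α : G → WeakDual ℂ E → WeakDual ℂ E),
        IsWeakStarAffineAction α → (∃ φ, HasNormBoundedOrbit α φ) → ∃ φ, ∀ t, α t φ = φ) ∧
    (IsAmenableGroup G ↔
      ∀ (E : Type (max u v)) [NormedAddCommGroup E] [NormedSpace ℂ E] [CompleteSpace E]
        (α : G → WeakDual ℂ E → WeakDual ℂ E),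
        IsWeakStarAffineAction α → (∀ φ, HasNormBoundedOrbit α φ) → ∃ φ, ∀ t, α t φ = φ) := by
  have h12 : IsAmenableGroup G → ∀ (E : Type (max u v)) [NormedAddCommGroup E]
      [NormedSpace ℂ E] [CompleteSpace E] (α : G → WeakDual ℂ E → WeakDual ℂ E),
      IsWeakStarAffineAction α → (∃ φ, HasNormBoundedOrbit α φ) → ∃ φ, ∀ t, α t φ = φ :=
    fun ⟨_, hm⟩ _ _ _ _ _ hα ⟨_, hφ⟩ => hm.exists_fixed_point hα hφ
  have h31 : BoundedOrbitsFixedPointProperty.{u, v} G → IsAmenableGroup G := fun H =>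
    let ⟨_, hP⟩ := H.exists_isUniformMean
    hP.isAmenableGroup
  exact ⟨⟨h12, fun H => h31 fun E _ _ _ α hα hb => H E α hα ⟨0, hb 0⟩⟩,
    ⟨fun h E _ _ _ α hα hb => h12 h E α hα ⟨0, hb 0⟩, h31⟩⟩
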